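/- Let $H=\{x\in\mathbb R^{1,3}: x_0^2-x_1^2-x_2^2-x_3^2=1,\ x_0>0\}$ be hyperbolic 3-space, with its hyperbolic distance $d$ (so $\cosh d(x,y)=x_0y_0-x_1y_1-x_2y_2-x_3y_3$) and its Riemannian volume $\mathrm dx$. For $\rho\ge 0$ let $$K_\rho(x,y)=\frac{\sin(\rho\, d(x,y))}{\rho\,\sinh d(x,y)},$$ extended by continuity to $\rho=0$ and to $x=y$. The ten triangles of a 4-simplex correspond to the pairs $1\le i<j\le 5$ (each triangle being shared by exactly two of the five tetrahedra). For labels $\rho=(\rho_{ij})_{1\le i<j\le 5}$ with $\rho_{ij}\ge 0$, and a point $x_5\in H$, the 10j symbol is $$I_{10}(\rho)=\frac1{2\pi^2}\int_{H^4}\ \prod_{1\le i<j\le 5}K_{\rho_{ij}}(x_i,x_j)\ \mathrm dx_1\,\mathrm dx_2\,\mathrm dx_3\,\mathrm dx_4 .$$ Then for every $\kappa$ there is a constant $K_\kappa>0$ such that, for every set $S$ of $\kappa$ of the ten pairs $i<j$, all labels $\rho_{ij}\ge 0$ with $\rho_{ij}>0$ for $(i,j)\in S$, and every $x_5\in H$,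 the integral defining $I_{10}(\rho)$ converges absolutely and $$|I_{10}(\rho)|\le\frac{K_\kappa}{\Bigl(\prod_{(i,j)\in S}\rho_{ij}\Bigr)^{3/10}} .$$ -/

import Mathlib

noncomputable section

namespace TenJ

/-- Minkowski space `ℝ^{1,3}`, written as (time coordinate, space coordinates). -/
abbrev Minkowski : Type := ℝ × EuclideanSpace ℝ (Fin 3)

/-- The Minkowski form with signature `(+,-,-,-)`. -/
def form (x y : Minkowski) : ℝ := x.1 * y.1 - inner ℝ x.2 y.2

/-- Hyperbolic 3-space `H`: the upper sheet of the two-sheeted unit hyperboloid. -/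
def Hyp : Type := {x : Minkowski // form x x = 1 ∧ 0 < x.1}

instance : MeasurableSpace Hyp := inferInstanceAs (MeasurableSpace (Subtype _))

/-- The hyperbolic distance on `H`, determined by `cosh d(x,y) = form x y`. -/
def hdist (x y : Hyp) : ℝ := Real.arcosh (form x.1 y.1)

/-- The point of `H` lying over given space coordinates. -/
def ofSpace (v : EuclideanSpace ℝ (Fin 3)) : Hyp :=
  ⟨(Real.sqrt (1 + ‖v‖ ^ 2), v), by
    have h : 0 < 1 + ‖v‖ ^ 2 := by positivity
    constructor
    · simp only [form, real_inner_self_eq_norm_sq, Real.mul_self_sqrt h.le]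
      ring
    · exact Real.sqrt_pos.mpr h⟩

theorem measurable_ofSpace : Measurable ofSpace := by
  refine Measurable.subtype_mk ?_
  fun_prop

/-- The Riemannian volume of `H`, which in the space coordinates is
`dv / √(1 + |v|²)`, and in geodesic polar coordinates `sinh² r dr dΩ`. -/
def hypVolume : MeasureTheory.Measure Hyp :=
  (MeasureTheory.volume.withDensity
    (fun v : EuclideanSpace ℝ (Fin 3) => ENNReal.ofReal (1 / Real.sqrt (1 + ‖v‖ ^ 2)))).map ofSpace

open Classical in
/-- The kernel `K_ρ(x,y) = sin (ρ d) / (ρ sinh d)`, `d = d(x,y)`, extended by continuity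
to `d = 0` (value `1`) and to `ρ = 0` (value `d / sinh d`). -/
def kernel (ρ : ℝ) (x y : Hyp) : ℝ :=
  if hdist x y = 0 then 1
  else if ρ = 0 then hdist x y / Real.sinh (hdist x y)
  else Real.sin (ρ * hdist x y) / (ρ * Real.sinh (hdist x y))

/-- The ten links of the spin network, i.e. the ten triangles of a 4-simplex: each triangle is
shared by exactly two of the five tetrahedra, and is recorded as that pair `i < j`. -/
abbrev Face : Type := {e : Fin 5 × Fin 5 // e.1 < e.2}

/-- The integrand `∏_{i<j} K_{ρ_ij}(x_i, x_j)` as a function of the first four points,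
with the fifth point held fixed. -/
def integrand (ρ : Face → ℝ) (x₅ : Hyp) (x : Fin 4 → Hyp) : ℝ :=
  ∏ e : Face, kernel (ρ e)
    (Fin.snoc (α := fun _ => Hyp) x x₅ e.1.1) (Fin.snoc (α := fun _ => Hyp) x x₅ e.1.2)

/-- The volume on `H⁴`. -/
def hypVolume4 : MeasureTheory.Measure (Fin 4 → Hyp) :=
  MeasureTheory.Measure.pi (fun _ => hypVolume)

/-- The 10j symbol, with the integration over the fifth point dropped. -/
def I10 (ρ : Face → ℝ) (x₅ : Hyp) : ℝ :=
  1 / (2 * Real.pi ^ 2) * ∫ x, integrand ρ x₅ x ∂hypVolume4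

end TenJ

end

/-!
Write `d` for the hyperbolic distance and `c = cosh d`. Since `|sin u| ≤ min u 1 ≤ u ^ (7/10)`, the
kernel satisfies both `|K_ρ| ≤ d / sinh d` and, for `ρ > 0`,
`|K_ρ| ≤ ρ ^ (-3/10) * d ^ (7/10) / sinh d`. In either case the factor depending on `d` is at most a
constant times `d ^ (-3/10) * c ^ (-9/10) = G ^ (2/5)`, where `G = d ^ (-3/4) * c ^ (-9/4)` is
`majorant` (`enorm_kernel_le`). The labels in `S` thus contribute `(∏ ρ) ^ (-3/10)`, and it remains
to bound the integral of `∏ G ^ (2/5)` over the ten edges of the complete graph `K₅`.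

Each edge of `K₅` lies in exactly two of its five spanning stars, so this product is the geometric
mean over the five vertices `i` of `∏_{j ≠ i} G(x_i, x_j)`, and Hölder's inequality bounds its
integral by the geometric mean of the five star integrals (`lintegral_prod_majorant_le`). A star
integral factorizes: it equals `M ^ 4`, where `M = ∫_H G(d(x, y)) dy` (`lintegral_star`).

It remains to see that `M` is finite and independent of `x`. After a rotation of space, `x` lies on
the first axis. Substituting `u = m sinh t` for the first coordinate of `y`, where
`m = √(1 + w₀² + w₁²)` and `w` are the other two coordinates, turns the volume into `dt dw` and a
boost along the first axis into a translation of `t` (`lintegral_form`). Hence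
`M = ∫∫ G dt dw` with `cosh d = m cosh t`. Here `d ≥ |t|`, so the integrand is bounded by
`m ^ (-9/4) * |t| ^ (-3/4) * cosh t ^ (-9/4)`, which is integrable as `9/4 > 2` and `3/4 < 1`
(`majorantMass_lt_top`). Powers and integrals of `G` are taken in `ℝ≥0∞`, where `G` is infinite on
the diagonal, so that no null set has to be discarded.
-/

open MeasureTheory Real
open scoped ENNReal

namespace TenJ

/-! ### Pointwise bounds on the kernel -/

theorem one_le_form (x y : Hyp) : 1 ≤ form x.1 y.1 := by
  obtain ⟨⟨a, v⟩, ha, ha'⟩ := x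
  obtain ⟨⟨b, w⟩, hb, hb'⟩ := y
  have hv := ha
  have hw := hb
  simp only [form, real_inner_self_eq_norm_sq] at hv hw ⊢
  dsimp only at ha' hb'
  have h := real_inner_le_norm v w
  have h2 : 1 + ‖v‖ * ‖w‖ ≤ a * b := by
    refine abs_le_of_sq_le_sq' ?_ (by positivity) |>.2
    have : (a * b) ^ 2 = (1 + ‖v‖ ^ 2) * (1 + ‖w‖ ^ 2) := by
      rw [show 1 + ‖v‖ ^ 2 = a * a by linarith, show 1 + ‖w‖ ^ 2 = b * b by linarith]; ring
    nlinarith [sq_nonneg (‖v‖ - ‖w‖)]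
  linarith

theorem form_comm (x y : Minkowski) : form x y = form y x := by
  simp only [form, real_inner_comm, mul_comm]

/-- The pairwise majorant of `|K_ρ|^(5/2)`, up to a constant, as a function of
`c = cosh d`. It takes values in `ℝ≥0∞`, so that it is infinite on the diagonal `c = 1`. -/
noncomputable def majorant (c : ℝ) : ℝ≥0∞ :=
  ENNReal.ofReal (arcosh c) ^ (-(3 / 4) : ℝ) * ENNReal.ofReal c ^ (-(9 / 4) : ℝ)

theorem measurable_arcosh : Measurable arcosh := by
  unfold arcosh
  fun_prop

theorem measurable_majorant : Measurable majorant := by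
  unfold majorant
  have := measurable_arcosh
  fun_prop

/-- Elementary comparison behind the kernel bound: `tanh d ≥ d / (1 + d)`, and the polynomial
factor is absorbed by a tenth power of `cosh d`. -/
theorem mul_cosh_rpow_le_sinh {d : ℝ} (hd : 0 ≤ d) :
    d * (1 + d) * cosh d ^ (9 / 10 : ℝ) ≤ 800 * sinh d := by
  have hc := cosh_pos d
  have h1 : d * cosh d ≤ (1 + d) * sinh d := by
    have h2 := self_le_sinh_iff.2 hd
    have h3 : d * exp (-d) ≤ d := mul_le_of_le_one_right hd (exp_le_one_iff.2 (by linarith))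
    have h4 := cosh_sub_sinh d
    rw [← h4] at h3
    linarith
  have h2 : (1 + d) ^ 2 ≤ 800 * cosh d ^ (1 / 10 : ℝ) := by
    have e1 : 1 + d ≤ 20 * exp (d / 20) := by linarith [add_one_le_exp (d / 20)]
    have e2 : (1 + d) ^ 2 ≤ 400 * exp (d / 10) := by
      calc (1 + d) ^ 2 ≤ (20 * exp (d / 20)) ^ 2 := by gcongr
        _ = 400 * (exp (d / 20) * exp (d / 20)) := by ring
        _ = _ := by rw [← exp_add]; ring_nf
    have e3 : exp (d / 10) ≤ (2 * cosh d) ^ (1 / 10 : ℝ) := by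
      rw [show d / 10 = d * (1 / 10) by ring, exp_mul]
      gcongr
      rw [cosh_eq]
      linarith [exp_pos (-d)]
    have e4 : (2 : ℝ) ^ (1 / 10 : ℝ) ≤ 2 := by
      simpa using rpow_le_rpow_of_exponent_le (x := 2) (by norm_num)
        (show (1 / 10 : ℝ) ≤ 1 by norm_num)
    rw [mul_rpow (by norm_num) hc.le] at e3
    have : (0 : ℝ) ≤ cosh d ^ (1 / 10 : ℝ) := by positivity
    nlinarith
  have h3 : cosh d ^ (9 / 10 : ℝ) * cosh d ^ (1 / 10 : ℝ) = cosh d := by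
    rw [← rpow_add hc]; norm_num
  have hp : 0 < cosh d ^ (1 / 10 : ℝ) := by positivity
  refine le_of_mul_le_mul_right ?_ hp
  have hs : 0 ≤ sinh d := sinh_nonneg_iff.2 hd
  calc d * (1 + d) * cosh d ^ (9 / 10 : ℝ) * cosh d ^ (1 / 10 : ℝ)
      = (1 + d) * (d * cosh d) := by rw [mul_assoc _ (cosh d ^ _), h3]; ring
    _ ≤ (1 + d) * ((1 + d) * sinh d) := by gcongr
    _ = (1 + d) ^ 2 * sinh d := by ring
    _ ≤ 800 * cosh d ^ (1 / 10 : ℝ) * sinh d := by gcongr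
    _ = _ := by ring

theorem rpow_div_sinh_le {d s : ℝ} (hd : 0 < d) (hs : 7 / 10 ≤ s) (hs' : s ≤ 1) :
    d ^ s / sinh d ≤ 800 * (d ^ (-(3 / 10) : ℝ) * cosh d ^ (-(9 / 10) : ℝ)) := by
  have hc := cosh_pos d
  have h := mul_cosh_rpow_le_sinh hd.le
  have h1 : d ^ s ≤ d ^ (-(3 / 10) : ℝ) * (d * (1 + d)) := by
    have : d ^ s = d ^ (-(3 / 10) : ℝ) * (d * d ^ (s - 7 / 10)) := by
      nth_rewrite 3 [← rpow_one d]
      rw [← rpow_add hd, ← rpow_add hd]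
      ring_nf
    rw [this]
    gcongr
    calc d ^ (s - 7 / 10) ≤ (1 + d) ^ (s - 7 / 10) := by gcongr; linarith
      _ ≤ (1 + d) ^ (1 : ℝ) := rpow_le_rpow_of_exponent_le (by linarith) (by linarith)
      _ = 1 + d := rpow_one _
  rw [div_le_iff₀ (sinh_pos_iff.2 hd)]
  calc d ^ s ≤ d ^ (-(3 / 10) : ℝ) * (d * (1 + d)) := h1
    _ = d ^ (-(3 / 10) : ℝ) * cosh d ^ (-(9 / 10) : ℝ) * (d * (1 + d) * cosh d ^ (9 / 10 : ℝ)) := by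
      rw [rpow_neg hc.le]
      field_simp
    _ ≤ d ^ (-(3 / 10) : ℝ) * cosh d ^ (-(9 / 10) : ℝ) * (800 * sinh d) := by gcongr
    _ = _ := by ring

theorem abs_sin_le_rpow {u : ℝ} (hu : 0 ≤ u) : |sin u| ≤ u ^ (7 / 10 : ℝ) := by
  rcases le_total u 1 with h | h
  · calc |sin u| ≤ u := by simpa [abs_of_nonneg hu] using abs_sin_le_abs (x := u)
      _ = u ^ (1 : ℝ) := (rpow_one u).symm
      _ ≤ _ := rpow_le_rpow_of_exponent_ge' hu h (by norm_num) (by norm_num)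
  · exact (abs_sin_le_one u).trans (one_le_rpow h (by norm_num))

theorem hdist_nonneg (x y : Hyp) : 0 ≤ hdist x y := arcosh_nonneg (one_le_form x y)

theorem cosh_hdist (x y : Hyp) : cosh (hdist x y) = form x.1 y.1 := cosh_arcosh (one_le_form x y)

theorem abs_kernel_le {ρ : ℝ} (hρ : 0 ≤ ρ) {x y : Hyp} (hd : 0 < hdist x y) :
    |kernel ρ x y| ≤
      800 * (hdist x y ^ (-(3 / 10) : ℝ) * form x.1 y.1 ^ (-(9 / 10) : ℝ)) := by
  rw [← cosh_hdist]
  refine le_trans ?_ (rpow_div_sinh_le hd (s := 1) (by norm_num) le_rfl)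
  have hs := sinh_pos_iff.2 hd
  rw [rpow_one, kernel, if_neg hd.ne']
  split_ifs with h
  · rw [abs_of_nonneg (by positivity)]
  · have hρ' : 0 < ρ := lt_of_le_of_ne hρ (Ne.symm h)
    rw [abs_div, abs_of_pos (a := ρ * sinh _) (by positivity), div_le_div_iff₀ (by positivity) hs]
    have := abs_sin_le_abs (x := ρ * hdist x y)
    rw [abs_of_pos (a := ρ * _) (by positivity)] at this
    nlinarith

/-- Interpolating `|sin u| ≤ u` and `|sin u| ≤ 1` extracts a decay `ρ^(-3/10)` at the price of a
mild singularity on the diagonal. -/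
theorem abs_kernel_le_of_pos {ρ : ℝ} (hρ : 0 < ρ) {x y : Hyp} (hd : 0 < hdist x y) :
    |kernel ρ x y| ≤ ρ ^ (-(3 / 10) : ℝ) *
      (800 * (hdist x y ^ (-(3 / 10) : ℝ) * form x.1 y.1 ^ (-(9 / 10) : ℝ))) := by
  rw [← cosh_hdist]
  refine le_trans ?_ (mul_le_mul_of_nonneg_left
    (rpow_div_sinh_le hd (s := 7 / 10) le_rfl (by norm_num)) (by positivity))
  have hs := sinh_pos_iff.2 hd
  rw [kernel, if_neg hd.ne', if_neg hρ.ne', abs_div, abs_of_pos (a := ρ * sinh _) (by positivity)]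
  have := abs_sin_le_rpow (u := ρ * hdist x y) (by positivity)
  rw [mul_rpow hρ.le hd.le] at this
  have h2 : ρ ^ (7 / 10 : ℝ) = ρ ^ (-(3 / 10) : ℝ) * ρ := by
    nth_rewrite 3 [← rpow_one ρ]
    rw [← rpow_add hρ]
    norm_num
  calc _ ≤ ρ ^ (7 / 10 : ℝ) * hdist x y ^ (7 / 10 : ℝ) / (ρ * sinh (hdist x y)) := by gcongr
    _ = _ := by rw [h2]; field_simp

/-- The exponents of `majorant` are those of the kernel bound times `5/2`. -/
theorem majorant_rpow {x y : Hyp} (hd : 0 < hdist x y) :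
    majorant (form x.1 y.1) ^ (2 / 5 : ℝ) =
      ENNReal.ofReal (hdist x y ^ (-(3 / 10) : ℝ) * form x.1 y.1 ^ (-(9 / 10) : ℝ)) := by
  have hf : 0 < form x.1 y.1 := one_pos.trans_le (one_le_form x y)
  rw [majorant, ENNReal.mul_rpow_of_nonneg _ _ (by norm_num), ← ENNReal.rpow_mul,
    ← ENNReal.rpow_mul, ENNReal.ofReal_mul (by positivity), ← ENNReal.ofReal_rpow_of_pos hd,
    ← ENNReal.ofReal_rpow_of_pos hf]
  norm_num
  rfl

theorem majorant_rpow_of_hdist_eq_zero {x y : Hyp} (hd : hdist x y = 0) :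
    majorant (form x.1 y.1) ^ (2 / 5 : ℝ) = ∞ := by
  have : arcosh (form x.1 y.1) = 0 := hd
  have hf : ENNReal.ofReal (form x.1 y.1) ^ (-(9 / 4) : ℝ) ≠ 0 := by
    simp only [ne_eq, ENNReal.rpow_eq_zero_iff, ENNReal.ofReal_ne_top, false_and, or_false]
    norm_num
  rw [majorant, this, ENNReal.ofReal_zero, ENNReal.zero_rpow_of_neg (by norm_num),
    ENNReal.top_mul hf, ENNReal.top_rpow_of_pos (by norm_num)]

/-- A label in `S` contributes the decay `ρ^(-3/10)`, any other label none. -/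
theorem enorm_kernel_le {ρ : ℝ} (hρ : 0 ≤ ρ) (P : Prop) [Decidable P] (hP : P → 0 < ρ)
    (x y : Hyp) :
    ‖kernel ρ x y‖ₑ ≤ ENNReal.ofReal (if P then ρ ^ (-(3 / 10) : ℝ) else 1) *
      (ENNReal.ofReal 800 * majorant (form x.1 y.1) ^ (2 / 5 : ℝ)) := by
  rcases (hdist_nonneg x y).eq_or_lt with hd | hd
  · rw [majorant_rpow_of_hdist_eq_zero hd.symm, ENNReal.mul_top (by norm_num), ENNReal.mul_top]
    · exact le_top
    · split_ifs with h
      · have := hP h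
        simp only [ne_eq, ENNReal.ofReal_eq_zero, not_le]
        positivity
      · simp
  · rw [majorant_rpow hd, ← ENNReal.ofReal_mul (by norm_num), Real.enorm_eq_ofReal_abs]
    split_ifs with h
    · have := hP h
      rw [← ENNReal.ofReal_mul (by positivity)]
      exact ENNReal.ofReal_le_ofReal (abs_kernel_le_of_pos this hd)
    · rw [ENNReal.ofReal_one, one_mul]
      exact ENNReal.ofReal_le_ofReal (abs_kernel_le hρ hd)

/-! ### Integration over hyperbolic space in rapidity coordinates -/

theorem lintegral_hypVolume {f : Hyp → ℝ≥0∞} (hf : Measurable f) :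
    ∫⁻ y, f y ∂hypVolume =
      ∫⁻ v, ENNReal.ofReal (1 / √(1 + ‖v‖ ^ 2)) * f (ofSpace v) := by
  rw [hypVolume, lintegral_map hf measurable_ofSpace, 
    lintegral_withDensity_eq_lintegral_mul _ (by fun_prop)
      (show Measurable fun v => f (ofSpace v) from hf.comp measurable_ofSpace)]
  rfl

/-- Rapidity substitution `u = m sinh t` in the mass shell measure `du / √(m² + u²)`. -/
theorem lintegral_rapidity {m : ℝ} (hm : 0 < m) (g : ℝ → ℝ → ℝ≥0∞) :
    ∫⁻ u, ENNReal.ofReal (1 / √(m ^ 2 + u ^ 2)) * g (√(m ^ 2 + u ^ 2)) u =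
      ∫⁻ t, g (m * cosh t) (m * sinh t) := by
  have hsurj : (fun t => m * sinh t) '' Set.univ = Set.univ := by
    rw [Set.image_univ, Set.range_eq_univ]
    intro u
    exact ⟨arsinh (u / m), by simp only [sinh_arsinh]; field_simp⟩
  have key := lintegral_image_eq_lintegral_abs_deriv_mul (s := Set.univ)
    (f := fun t => m * sinh t) (f' := fun t => m * cosh t) MeasurableSet.univ
    (fun x _ => ((hasDerivAt_sinh x).const_mul m).hasDerivWithinAt)
    (fun x _ y _ h => sinh_injective (mul_left_cancel₀ hm.ne' h))
    (fun u => ENNReal.ofReal (1 / √(m ^ 2 + u ^ 2)) * g (√(m ^ 2 + u ^ 2)) u)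
  rw [hsurj, setLIntegral_univ, setLIntegral_univ] at key
  rw [key]
  refine lintegral_congr fun t => ?_
  have hp : 0 < m * cosh t := mul_pos hm (cosh_pos t)
  have hsq : √(m ^ 2 + (m * sinh t) ^ 2) = m * cosh t := by
    rw [← sqrt_sq hp.le, mul_pow m (cosh t), cosh_sq]
    ring_nf
  simp only [hsq]
  rw [← mul_assoc, abs_of_pos hp, ← ENNReal.ofReal_mul hp.le, mul_one_div_cancel hp.ne',
    ENNReal.ofReal_one, one_mul]

/-- A boost is a translation in the rapidity `t`. -/
theorem lintegral_boost {m : ℝ} (hm : 0 < m) (s : ℝ) (F : ℝ → ℝ≥0∞) :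
    ∫⁻ u, ENNReal.ofReal (1 / √(m ^ 2 + u ^ 2)) * F (cosh s * √(m ^ 2 + u ^ 2) - sinh s * u) =
      ∫⁻ t, F (m * cosh t) := by
  rw [lintegral_rapidity hm (fun E u => F (cosh s * E - sinh s * u)),
    ← lintegral_sub_right_eq_self (fun t => F (m * cosh t)) s]
  refine lintegral_congr fun t => ?_
  rw [cosh_sub]
  ring_nf

/-- Cartesian coordinates on `ℝ³`, with the first one split off. -/
theorem lintegral_euclidean_three {f : ℝ → (Fin 2 → ℝ) → ℝ≥0∞}
    (hf : Measurable (Function.uncurry f)) :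
    ∫⁻ v : EuclideanSpace ℝ (Fin 3), f (v 0) (fun i => v i.succ) =
      ∫⁻ w : Fin 2 → ℝ, ∫⁻ u, f u w := by
  have e1 := EuclideanSpace.volume_preserving_symm_measurableEquiv_toLp (Fin 3)
  have e2 := volume_preserving_piFinSuccAbove (fun _ : Fin 3 => ℝ) 0
  have h := (e2.comp e1).lintegral_comp hf
  rw [Measure.volume_eq_prod, lintegral_prod_symm' _ hf] at h
  exact h

/-- The reflection exchanging `a` with `‖a‖ e₀` turns the inner product with `a` into a multiple of
the first coordinate. -/
theorem exists_linearIsometryEquiv_eq_single (a : EuclideanSpace ℝ (Fin 3)) :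
    ∃ R : EuclideanSpace ℝ (Fin 3) ≃ₗᵢ[ℝ] EuclideanSpace ℝ (Fin 3),
      ∀ v, inner ℝ a (R v) = ‖a‖ * v 0 := by
  have h : ‖EuclideanSpace.single (0 : Fin 3) ‖a‖‖ = ‖a‖ := by simp
  refine ⟨(ℝ ∙ (EuclideanSpace.single (0 : Fin 3) ‖a‖ - a))ᗮ.reflection, fun v => ?_⟩
  nth_rewrite 1 [← Submodule.reflection_sub h]
  rw [LinearIsometryEquiv.inner_map_map, EuclideanSpace.inner_single_left]
  simp

/-- The integral of a function of `d(x, y)` over `y ∈ H` does not depend on `x`: a rotation moves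
`x` onto the first axis, and a boost along that axis moves it to the origin. -/
theorem lintegral_form (F : ℝ → ℝ≥0∞) (hF : Measurable F) (x : Hyp) :
    ∫⁻ y, F (form x.1 y.1) ∂hypVolume =
      ∫⁻ w : Fin 2 → ℝ, ∫⁻ t, F (√(1 + w 0 ^ 2 + w 1 ^ 2) * cosh t) := by
  have hform : Measurable fun y : Hyp => form x.1 y.1 := by
    unfold form
    have : Measurable fun y : Hyp => y.1 := measurable_subtype_coe
    fun_prop
  rw [lintegral_hypVolume (f := fun y => F (form x.1 y.1)) (hF.comp hform)]
  obtain ⟨⟨a, v⟩, ha, ha'⟩ := x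
  simp only [form, real_inner_self_eq_norm_sq] at ha
  obtain ⟨R, hR⟩ := exists_linearIsometryEquiv_eq_single v
  set s := arsinh ‖v‖ with hs
  have hsinh : sinh s = ‖v‖ := sinh_arsinh _
  have hcosh : cosh s = a := by
    have h1 := cosh_sq s
    rw [hsinh] at h1
    have := cosh_pos s
    dsimp only at ha'
    nlinarith
  rw [← R.measurePreserving.lintegral_comp (by unfold ofSpace form at *; simp only at *; fun_prop)]
  simp only [ofSpace, form, hR, LinearIsometryEquiv.norm_map]
  have hn : ∀ v : EuclideanSpace ℝ (Fin 3),
      1 + ‖v‖ ^ 2 = √(1 + v (Fin.succ 0) ^ 2 + v (Fin.succ 1) ^ 2) ^ 2 + v 0 ^ 2 := by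
    intro v
    rw [EuclideanSpace.norm_sq_eq, Fin.sum_univ_three, sq_sqrt (by positivity)]
    simp
    ring
  simp only [hn]
  rw [lintegral_euclidean_three (f := fun u w =>
    ENNReal.ofReal (1 / √(√(1 + w 0 ^ 2 + w 1 ^ 2) ^ 2 + u ^ 2)) *
      F (a * √(√(1 + w 0 ^ 2 + w 1 ^ 2) ^ 2 + u ^ 2) - ‖v‖ * u))
    (by unfold Function.uncurry; fun_prop)]
  refine lintegral_congr fun w => ?_
  rw [← hcosh, ← hsinh, lintegral_boost (by positivity)]

/-! ### Finite mass of the pairwise majorant -/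

theorem sqrt_one_add_sq_le_cosh (t : ℝ) : √(1 + t ^ 2) ≤ cosh t := by
  rw [sqrt_le_left (cosh_pos t).le, cosh_sq, ← sq_abs t, ← sq_abs (sinh t), abs_sinh]
  have := self_le_sinh_iff.2 (abs_nonneg t)
  nlinarith [abs_nonneg t]

theorem sqrt_rpow_eq {b : ℝ} (hb : 0 ≤ b) :
    √b ^ (-(9 / 4) : ℝ) = b ^ (-(9 / 4) / 2 : ℝ) := by
  rw [sqrt_eq_rpow, ← rpow_mul hb]
  norm_num

/-- The transverse plane is two-dimensional, and `9/4 > 2`. -/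
theorem lintegral_transverse_lt_top :
    ∫⁻ w : Fin 2 → ℝ, ENNReal.ofReal √(1 + w 0 ^ 2 + w 1 ^ 2) ^ (-(9 / 4) : ℝ) < ∞ := by
  have h := integrable_rpow_neg_one_add_norm_sq (E := Fin 2 → ℝ) (μ := volume) (r := 9 / 4)
    (by norm_num)
  refine lt_of_le_of_lt (lintegral_mono fun w => ?_) h.lintegral_lt_top
  have hpos : 0 < √(1 + w 0 ^ 2 + w 1 ^ 2) := by positivity
  rw [ENNReal.ofReal_rpow_of_pos hpos, sqrt_rpow_eq (by positivity)]
  refine ENNReal.ofReal_le_ofReal (rpow_le_rpow_of_nonpos (by positivity) ?_ (by norm_num))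
  have : ‖w‖ ≤ √(w 0 ^ 2 + w 1 ^ 2) := by
    refine (pi_norm_le_iff_of_nonneg (by positivity)).2 fun i => abs_le_sqrt ?_
    fin_cases i <;> simp <;> positivity
  have h2 : ‖w‖ ^ 2 ≤ w 0 ^ 2 + w 1 ^ 2 := (le_sqrt (by positivity) (by positivity)).1 this
  linarith

/-- The singularity `|t|^(-3/4)` is integrable near `0`, and `cosh t ^ (-9/4)` at infinity. -/
theorem lintegral_rapidity_majorant_lt_top :
    ∫⁻ t : ℝ, ENNReal.ofReal |t| ^ (-(3 / 4) : ℝ) * ENNReal.ofReal (cosh t) ^ (-(9 / 4) : ℝ)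
      < ∞ := by
  have h := integrable_rpow_neg_one_add_norm_sq (E := ℝ) (μ := volume) (r := 9 / 4)
    (by norm_num)
  have hnear : ∫⁻ t in Set.Icc (-1 : ℝ) 1, ENNReal.ofReal |t| ^ (-(3 / 4) : ℝ) < ∞ := by
    have hpos : ∫⁻ t in Set.Ioc (0 : ℝ) 1, ENNReal.ofReal |t| ^ (-(3 / 4) : ℝ) < ∞ := by
      have := (intervalIntegral.intervalIntegrable_rpow' (a := 0) (b := 1)
        (r := -(3 / 4)) (by norm_num)).1.lintegral_lt_top
      refine lt_of_le_of_lt (le_of_eq ?_) this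
      refine setLIntegral_congr_fun measurableSet_Ioc fun t ht => ?_
      rw [abs_of_pos ht.1, ENNReal.ofReal_rpow_of_pos ht.1]
    have hneg : ∫⁻ t in Set.Ico (-1 : ℝ) 0, ENNReal.ofReal |t| ^ (-(3 / 4) : ℝ) < ∞ := by
      refine lt_of_le_of_lt (le_of_eq ?_) hpos
      have := (Measure.measurePreserving_neg (volume : Measure ℝ)).setLIntegral_comp_preimage
        (s := Set.Ioc 0 1) measurableSet_Ioc
        (f := fun t => ENNReal.ofReal |t| ^ (-(3 / 4) : ℝ)) (by fun_prop)
      simpa using this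
    have hsub : Set.Icc (-1 : ℝ) 1 ⊆ (Set.Ico (-1) 0 ∪ Set.Ioc 0 1) ∪ {0} := by
      intro t ht
      rcases lt_trichotomy t 0 with h | h | h
      · exact Or.inl (Or.inl ⟨ht.1, h⟩)
      · exact Or.inr h
      · exact Or.inl (Or.inr ⟨h, ht.2⟩)
    refine (lintegral_mono_set hsub).trans_lt ((lintegral_union_le _ _ _).trans_lt ?_)
    refine ENNReal.add_lt_top.2 ⟨(lintegral_union_le _ _ _).trans_lt
      (ENNReal.add_lt_top.2 ⟨hneg, hpos⟩), ?_⟩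
    simp
  have hle : ∀ t : ℝ, ENNReal.ofReal |t| ^ (-(3 / 4) : ℝ) *
      ENNReal.ofReal (cosh t) ^ (-(9 / 4) : ℝ) ≤
      (Set.Icc (-1 : ℝ) 1).indicator (fun t => ENNReal.ofReal |t| ^ (-(3 / 4) : ℝ)) t +
        ENNReal.ofReal ((1 + ‖t‖ ^ 2) ^ (-(9 / 4) / 2 : ℝ)) := by
    intro t
    by_cases ht : t ∈ Set.Icc (-1 : ℝ) 1
    · rw [Set.indicator_of_mem ht]
      refine le_add_right (mul_le_of_le_one_right' ?_)
      refine ENNReal.rpow_le_one_of_one_le_of_neg ?_ (by norm_num)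
      simp
    · rw [Set.indicator_of_notMem ht, zero_add]
      refine (mul_le_of_le_one_left' (ENNReal.rpow_le_one_of_one_le_of_neg ?_ (by norm_num))).trans
        ?_
      · rw [Set.mem_Icc, ← abs_le, not_le] at ht
        simpa using ht.le
      · rw [ENNReal.ofReal_rpow_of_pos (cosh_pos t), ← sqrt_rpow_eq (by positivity),
          norm_eq_abs, sq_abs]
        exact ENNReal.ofReal_le_ofReal (rpow_le_rpow_of_nonpos (by positivity)
          (sqrt_one_add_sq_le_cosh t) (by norm_num))
  refine (lintegral_mono hle).trans_lt ?_
  rw [lintegral_add_right _ (by fun_prop), lintegral_indicator measurableSet_Icc]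
  exact ENNReal.add_lt_top.2 ⟨hnear, h.lintegral_lt_top⟩

/-- The majorant separates in the coordinates `(w, t)`, since `cosh d = m cosh t` with `m ≥ 1`
forces `d ≥ |t|`. -/
theorem majorant_mul_cosh_le {m : ℝ} (hm : 1 ≤ m) (t : ℝ) :
    majorant (m * cosh t) ≤ ENNReal.ofReal m ^ (-(9 / 4) : ℝ) *
      (ENNReal.ofReal |t| ^ (-(3 / 4) : ℝ) * ENNReal.ofReal (cosh t) ^ (-(9 / 4) : ℝ)) := by
  have hc := cosh_pos t
  have hmc : 0 < m * cosh t := by positivity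
  have hd : |t| ≤ arcosh (m * cosh t) := by
    rw [← arcosh_cosh (abs_nonneg t), arcosh_le_arcosh (cosh_pos _) hmc, cosh_abs]
    exact le_mul_of_one_le_left hc.le hm
  rw [majorant, ENNReal.ofReal_rpow_of_pos hmc, mul_rpow (by positivity) hc.le,
    ENNReal.ofReal_mul (by positivity), ← ENNReal.ofReal_rpow_of_pos hc,
    ← ENNReal.ofReal_rpow_of_pos (by positivity : 0 < m), mul_left_comm]
  refine mul_le_mul_right (mul_le_mul_left ?_ _) _
  rw [ENNReal.rpow_neg, ENNReal.rpow_neg]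
  gcongr

/-- The total mass `∫_H G(d(x, y)) dy` of the pairwise majorant, which does not depend on `x`. -/
noncomputable def majorantMass : ℝ≥0∞ :=
  ∫⁻ w : Fin 2 → ℝ, ∫⁻ t, majorant (√(1 + w 0 ^ 2 + w 1 ^ 2) * cosh t)

theorem lintegral_majorant (x : Hyp) :
    ∫⁻ y, majorant (form x.1 y.1) ∂hypVolume = majorantMass :=
  lintegral_form majorant measurable_majorant x

theorem majorantMass_lt_top : majorantMass < ∞ := by
  have hm : ∀ w : Fin 2 → ℝ, 1 ≤ √(1 + w 0 ^ 2 + w 1 ^ 2) := fun w => by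
    rw [one_le_sqrt]; nlinarith [sq_nonneg (w 0), sq_nonneg (w 1)]
  refine (lintegral_mono fun w => lintegral_mono fun t => majorant_mul_cosh_le (hm w) t).trans_lt ?_
  have hcosh : Measurable cosh := measurable_cosh
  simp_rw [lintegral_const_mul _ (show Measurable fun t : ℝ =>
    ENNReal.ofReal |t| ^ (-(3 / 4) : ℝ) * ENNReal.ofReal (cosh t) ^ (-(9 / 4) : ℝ) by fun_prop)]
  rw [lintegral_mul_const _ (by fun_prop)]
  exact ENNReal.mul_lt_top lintegral_transverse_lt_top lintegral_rapidity_majorant_lt_top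

/-! ### Measurability -/

theorem ofSpace_snd (x : Hyp) : ofSpace x.1.2 = x := by
  obtain ⟨⟨a, v⟩, ha, ha'⟩ := x
  have hv := ha
  simp only [form, real_inner_self_eq_norm_sq] at hv
  dsimp only at ha'
  refine Subtype.ext (Prod.ext ?_ rfl)
  change √(1 + ‖v‖ ^ 2) = a
  rw [show 1 + ‖v‖ ^ 2 = a ^ 2 by linarith, sqrt_sq ha'.le]

/-- The chart of `H` given by the space coordinates. -/
noncomputable def spaceEquiv : EuclideanSpace ℝ (Fin 3) ≃ᵐ Hyp where
  toFun := ofSpace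
  invFun x := x.1.2
  left_inv _ := rfl
  right_inv := ofSpace_snd
  measurable_toFun := measurable_ofSpace
  measurable_invFun := measurable_snd.comp measurable_subtype_coe

instance : SigmaFinite hypVolume := by
  have : SigmaFinite ((volume : Measure (EuclideanSpace ℝ (Fin 3))).withDensity
      (fun v => ENNReal.ofReal (1 / √(1 + ‖v‖ ^ 2)))) :=
    SigmaFinite.withDensity_ofReal _
  exact MeasurableEquiv.sigmaFinite_map spaceEquiv

theorem measurable_form {α : Type*} [MeasurableSpace α] {f g : α → Hyp} (hf : Measurable f)
    (hg : Measurable g) : Measurable fun a => form (f a).1 (g a).1 := by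
  have hf' : Measurable fun a => (f a).1 := measurable_subtype_coe.comp hf
  have hg' : Measurable fun a => (g a).1 := measurable_subtype_coe.comp hg
  unfold form
  fun_prop

theorem measurable_kernel {α : Type*} [MeasurableSpace α] (ρ : ℝ) {f g : α → Hyp}
    (hf : Measurable f) (hg : Measurable g) : Measurable fun a => kernel ρ (f a) (g a) := by
  have hd : Measurable fun a => hdist (f a) (g a) :=
    measurable_arcosh.comp (measurable_form hf hg)
  unfold kernel
  refine Measurable.ite (hd (measurableSet_singleton 0)) measurable_const ?_
  split_ifs
  · exact hd.div (measurable_sinh.comp hd)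
  · exact (measurable_sin.comp (hd.const_mul ρ)).div ((measurable_sinh.comp hd).const_mul ρ)

theorem measurable_majorant_form {α : Type*} [MeasurableSpace α] {f g : α → Hyp}
    (hf : Measurable f) (hg : Measurable g) :
    Measurable fun a => majorant (form (f a).1 (g a).1) :=
  measurable_majorant.comp (measurable_form hf hg)

/-- The five points `x₁, …, x₅`, the last of which is fixed. -/
def points (x₅ : Hyp) (x : Fin 4 → Hyp) : Fin 5 → Hyp := Fin.snoc (α := fun _ => Hyp) x x₅

theorem measurable_points (x₅ : Hyp) (i : Fin 5) : Measurable fun x => points x₅ x i := by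
  induction i using Fin.lastCases with
  | last =>
    simp only [points, Fin.snoc_last]
    exact measurable_const
  | cast i =>
    simp only [points, Fin.snoc_castSucc]
    exact measurable_pi_apply i

theorem measurable_integrand (ρ : Face → ℝ) (x₅ : Hyp) : Measurable (integrand ρ x₅) :=
  Finset.measurable_fun_prod _ fun e _ =>
    measurable_kernel (ρ e) (measurable_points x₅ e.1.1) (measurable_points x₅ e.1.2)

/-! ### Spanning stars of the complete graph on five vertices -/

/-- The integrand attached to the spanning star of `K₅` with centre `i`. -/
noncomputable def starProd (x₅ : Hyp) (i : Fin 5) (x : Fin 4 → Hyp) : ℝ≥0∞ :=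
  ∏ j : Fin 4, majorant (form (points x₅ x i).1 (points x₅ x (i.succAbove j)).1)

theorem measurable_star (x₅ : Hyp) (i : Fin 5) : Measurable (starProd x₅ i) :=
  Finset.measurable_fun_prod _ fun j _ =>
    measurable_majorant_form (measurable_points x₅ i) (measurable_points x₅ (i.succAbove j))

theorem lintegral_pi_prod {α : Type*} [MeasurableSpace α] (μ : Measure α) [SigmaFinite μ]
    {f : α → ℝ≥0∞} (hf : Measurable f) (n : ℕ) :
    ∫⁻ x : Fin n → α, ∏ j, f (x j) ∂Measure.pi (fun _ => μ) = (∫⁻ y, f y ∂μ) ^ n := by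
  induction n with
  | zero => simp
  | succ n ih =>
    have h := (measurePreserving_piFinSuccAbove (fun _ : Fin (n + 1) => μ) 0).lintegral_comp
      (f := fun p => f p.1 * ∏ j, f (p.2 j)) (by fun_prop)
    rw [lintegral_prod_mul (g := fun z : Fin n → α => ∏ j, f (z j)) (by fun_prop)
      (Measurable.aemeasurable (by fun_prop)), ih] at h
    rw [pow_succ', ← h]
    exact lintegral_congr fun x => Fin.prod_univ_succ _

theorem lintegral_majorant_symm (x : Hyp) :
    ∫⁻ y, majorant (form y.1 x.1) ∂hypVolume = majorantMass := by
  rw [← lintegral_majorant x]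
  exact lintegral_congr fun y => by rw [form_comm]

/-- Integrating out the leaves of a star, and then its centre if the fixed point is a leaf. -/
theorem lintegral_star (x₅ : Hyp) (i : Fin 5) :
    ∫⁻ x, starProd x₅ i x ∂hypVolume4 = majorantMass ^ 4 := by
  have hm : ∀ y : Hyp, Measurable fun z : Hyp => majorant (form y.1 z.1) := fun y =>
    measurable_majorant_form measurable_const measurable_id
  have hm' : Measurable fun z : Hyp => majorant (form z.1 x₅.1) :=
    measurable_majorant_form measurable_id measurable_const
  induction i using Fin.lastCases with
  | last =>
    have : ∀ x, starProd x₅ (Fin.last 4) x = ∏ j, majorant (form x₅.1 (x j).1) := fun x => by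
      simp only [starProd, points, Fin.succAbove_last, Fin.snoc_last, Fin.snoc_castSucc]
    simp_rw [this]
    rw [hypVolume4, lintegral_pi_prod hypVolume (hm x₅), lintegral_majorant]
  | cast k =>
    have hstar : ∀ x, starProd x₅ k.castSucc x = majorant (form (x k).1 x₅.1) *
        ∏ j : Fin 3, majorant (form (x k).1 (x (k.succAbove j)).1) := fun x => by
      rw [starProd, Fin.prod_univ_castSucc, mul_comm]
      have hk : k.castSucc.succAbove (Fin.last 3) = Fin.last 4 := by decide +revert
      simp only [points, hk, Fin.castSucc_succAbove_castSucc, Fin.snoc_last, Fin.snoc_castSucc]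
    have hmeas : Measurable fun p : Hyp × (Fin 3 → Hyp) => majorant (form p.1.1 x₅.1) *
        ∏ j : Fin 3, majorant (form p.1.1 (p.2 j).1) := by
      refine (hm'.comp measurable_fst).mul (Finset.measurable_fun_prod _ fun j _ => ?_)
      exact measurable_majorant_form measurable_fst ((measurable_pi_apply j).comp measurable_snd)
    have h := (measurePreserving_piFinSuccAbove (fun _ : Fin 4 => hypVolume) k).lintegral_comp hmeas
    have hinner : ∀ y : Hyp, ∫⁻ z : Fin 3 → Hyp, majorant (form y.1 x₅.1) *
        ∏ j : Fin 3, majorant (form y.1 (z j).1) ∂Measure.pi (fun _ => hypVolume) =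
        majorant (form y.1 x₅.1) * majorantMass ^ 3 := fun y => by
      rw [lintegral_const_mul _ (Finset.measurable_fun_prod _ fun j _ =>
        measurable_majorant_form measurable_const (measurable_pi_apply j)),
        lintegral_pi_prod hypVolume (hm y), lintegral_majorant]
    rw [lintegral_prod _ hmeas.aemeasurable] at h
    simp_rw [hinner] at h
    rw [lintegral_mul_const _ hm', lintegral_majorant_symm, ← pow_succ'] at h
    rw [← h, hypVolume4]
    exact lintegral_congr hstar

/-- Every edge of `K₅` lies in exactly two of the five spanning stars. -/
theorem prod_face_eq_prod_star {M : Type*} [CommMonoid M] (a : Fin 5 → Fin 5 → M)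
    (ha : ∀ i j, a i j = a j i) :
    (∏ e : Face, a e.1.1 e.1.2) ^ 2 = ∏ i : Fin 5, ∏ j : Fin 4, a i (i.succAbove j) := by
  have h1 : ∏ e : Face, a e.1.1 e.1.2 =
      ∏ i : Fin 5, ∏ j : Fin 5, if i < j then a i j else 1 := by
    rw [← Finset.prod_subtype (Finset.univ.filter fun e : Fin 5 × Fin 5 => e.1 < e.2)
      (by simp) (fun e => a e.1 e.2), Finset.prod_filter, ← Finset.univ_product_univ,
      Finset.prod_product]
  have h2 : ∏ i : Fin 5, ∏ j : Fin 5, (if i < j then a i j else 1) =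
      ∏ i : Fin 5, ∏ j : Fin 5, (if j < i then a i j else 1) := by
    rw [Finset.prod_comm]
    simp_rw [ha]
  rw [sq]
  nth_rewrite 2 [h1]
  nth_rewrite 1 [h2]
  rw [h1, ← Finset.prod_mul_distrib]
  refine Finset.prod_congr rfl fun i _ => ?_
  rw [← Finset.prod_mul_distrib, Fin.prod_univ_succAbove _ i]
  simp only [lt_self_iff_false, if_false, one_mul]
  refine Finset.prod_congr rfl fun j _ => ?_
  rcases (i.succAbove_ne j).lt_or_gt with h | h
  · simp [h, h.not_gt]
  · simp [h, h.not_gt]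

theorem prod_majorant_eq (x₅ : Hyp) (x : Fin 4 → Hyp) :
    ∏ e : Face, majorant (form (points x₅ x e.1.1).1 (points x₅ x e.1.2).1) ^ (2 / 5 : ℝ) =
      ∏ i, starProd x₅ i x ^ (1 / 5 : ℝ) := by
  have h := prod_face_eq_prod_star
    (fun i j => majorant (form (points x₅ x i).1 (points x₅ x j).1))
    (fun i j => by rw [form_comm])
  rw [ENNReal.prod_rpow_of_nonneg (by norm_num), ENNReal.prod_rpow_of_nonneg (by norm_num)]
  simp only [starProd]
  rw [← h, ← ENNReal.rpow_natCast, ← ENNReal.rpow_mul]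
  norm_num

/-- Hölder's inequality over the five spanning stars of `K₅`. -/
theorem lintegral_prod_majorant_le (x₅ : Hyp) :
    ∫⁻ x, ∏ e : Face, majorant (form (points x₅ x e.1.1).1 (points x₅ x e.1.2).1) ^ (2 / 5 : ℝ)
      ∂hypVolume4 ≤ majorantMass ^ 4 := by
  simp_rw [prod_majorant_eq]
  refine (ENNReal.lintegral_prod_norm_pow_le Finset.univ
    (fun i _ => (measurable_star x₅ i).aemeasurable) (by simp) (fun _ _ => by norm_num)).trans ?_
  simp_rw [lintegral_star]
  rw [Finset.prod_const, ← ENNReal.rpow_natCast, ← ENNReal.rpow_mul]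
  simp

/-! ### The bound on the 10j symbol -/

open Classical in
/-- Absolute convergence with the decay in the labels of `S`: the finite factor on the right depends
neither on `S`, nor on the labels, nor on `x₅`. -/
theorem lintegral_enorm_integrand_le (S : Finset Face) {ρ : Face → ℝ} (hρ : ∀ e, 0 ≤ ρ e)
    (hS : ∀ e ∈ S, 0 < ρ e) (x₅ : Hyp) :
    ∫⁻ x, ‖integrand ρ x₅ x‖ₑ ∂hypVolume4 ≤
      ENNReal.ofReal ((∏ e ∈ S, ρ e) ^ (-(3 / 10) : ℝ)) *
        (ENNReal.ofReal 800 ^ 10 * majorantMass ^ 4) := by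
  have hcard : Fintype.card Face = 10 := by decide
  -- The factors outside `S` are `1`, so the product of the label factors runs over `S`.
  have hprod : ∏ e, ENNReal.ofReal (if e ∈ S then ρ e ^ (-(3 / 10) : ℝ) else 1) =
      ENNReal.ofReal ((∏ e ∈ S, ρ e) ^ (-(3 / 10) : ℝ)) := by
    rw [← ENNReal.ofReal_prod_of_nonneg, Finset.prod_ite_mem, Finset.univ_inter,
      Real.finsetProd_rpow _ _ fun e _ => hρ e]
    intro e _
    have := hρ e
    split_ifs <;> positivity
  have hpt : ∀ x, ‖integrand ρ x₅ x‖ₑ ≤ ENNReal.ofReal ((∏ e ∈ S, ρ e) ^ (-(3 / 10) : ℝ)) *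
      (ENNReal.ofReal 800 ^ 10 * ∏ e : Face,
        majorant (form (points x₅ x e.1.1).1 (points x₅ x e.1.2).1) ^ (2 / 5 : ℝ)) := fun x => by
    rw [integrand, enorm_eq_nnnorm, nnnorm_prod, ENNReal.ofNNReal_finsetProd]
    refine (Finset.prod_le_prod' fun e _ =>
      enorm_kernel_le (hρ e) (e ∈ S) (hS e) _ _).trans_eq ?_
    rw [Finset.prod_mul_distrib, Finset.prod_mul_distrib, hprod, Finset.prod_const,
      Finset.card_univ, hcard]
    rfl
  refine (lintegral_mono hpt).trans ?_
  rw [lintegral_const_mul' _ _ (by simp), lintegral_const_mul' _ _ (by simp)]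
  gcongr
  exact lintegral_prod_majorant_le x₅

end TenJ

theorem mainTheorem2 (κ : ℕ) :
    ∃ K : ℝ, 0 < K ∧
      ∀ S : Finset TenJ.Face, S.card = κ →
      ∀ ρ : TenJ.Face → ℝ, (∀ e, 0 ≤ ρ e) → (∀ e ∈ S, 0 < ρ e) →
      ∀ x₅ : TenJ.Hyp,
        MeasureTheory.Integrable (TenJ.integrand ρ x₅) TenJ.hypVolume4 ∧
        |TenJ.I10 ρ x₅| ≤ K / (∏ e ∈ S, ρ e) ^ (3 / 10 : ℝ) := by
  set C : ℝ≥0∞ := ENNReal.ofReal 800 ^ 10 * TenJ.majorantMass ^ 4 with hC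
  have hCtop : C ≠ ∞ := ENNReal.mul_ne_top (by simp)
    (ENNReal.pow_ne_top TenJ.majorantMass_lt_top.ne)
  -- One constant serves every `κ`; the summand `1` makes its positivity immediate.
  refine ⟨1 / (2 * π ^ 2) * C.toReal + 1, by positivity, fun S _ ρ hρ hS x₅ => ?_⟩
  have hle := TenJ.lintegral_enorm_integrand_le S hρ hS x₅
  rw [← hC] at hle
  have hP : 0 ≤ ∏ e ∈ S, ρ e := Finset.prod_nonneg fun e _ => hρ e
  refine ⟨⟨(TenJ.measurable_integrand ρ x₅).aestronglyMeasurable,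
    hle.trans_lt (ENNReal.mul_lt_top ENNReal.ofReal_lt_top hCtop.lt_top)⟩, ?_⟩
  have hint : |∫ x, TenJ.integrand ρ x₅ x ∂TenJ.hypVolume4| ≤
      (∏ e ∈ S, ρ e) ^ (-(3 / 10) : ℝ) * C.toReal := by
    have h := ENNReal.toReal_mono (ENNReal.mul_ne_top ENNReal.ofReal_ne_top hCtop)
      ((enorm_integral_le_lintegral_enorm _).trans hle)
    rwa [ENNReal.toReal_mul, ENNReal.toReal_ofReal (by positivity), toReal_enorm,
      norm_eq_abs] at h
  rw [TenJ.I10, abs_mul, abs_of_nonneg (a := 1 / (2 * π ^ 2)) (by positivity),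
    div_eq_mul_inv _ (_ ^ _), ← rpow_neg hP]
  have hR : 0 ≤ (∏ e ∈ S, ρ e) ^ (-(3 / 10) : ℝ) := by positivity
  calc 1 / (2 * π ^ 2) * |∫ x, TenJ.integrand ρ x₅ x ∂TenJ.hypVolume4|
      ≤ 1 / (2 * π ^ 2) * ((∏ e ∈ S, ρ e) ^ (-(3 / 10) : ℝ) * C.toReal) := by gcongr
    _ ≤ _ := by linarith
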